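/- Let $(M,g)$ and $(\tilde M,\tilde g)$ be smooth $n$-dimensional Riemannian manifolds (Hausdorff, second countable, without boundary), let $f:M\to\tilde M$ be a smooth diffeomorphism, let $k\ge 0$ be an integer and let $1\le p\le\tilde p<\infty$. Set $t=\frac{p}{\tilde p-p}\in(0,\infty]$, with $t=\infty$ if $\tilde p=p$. For $x\in M$ let $\lambda_1(x),\dots,\lambda_n(x)>0$ be the singular values of $df_x:T_xM\to T_{f(x)}\tilde M$ with respect to $g$ and $\tilde g$, and put $$\sigma_k(f,x)=\sum_{i_1<\dots<i_k}\lambda_{i_1}(x)\cdots\lambda_{i_k}(x)\quad(\sigma_0=1),\qquad J_f(x)=\sigma_n(f,x)=\lambda_1(x)\cdots\lambda_n(x).$$ For $1\le s<\infty$ and $0<r\le\infty$ let $$K_{s,r,k}(f)=\left\|\frac{\sigma_k(f)^{s}}{J_f}\right\|_{L^{r}(M)}\in[0,\infty],$$ where $\|h\|_{L^r(M)}=\left(\int_M|h|^r\,dx\right)^{1/r}$ for $r<\infty$, $\|h\|_{L^\infty(M)}$ is the essential supremum of $|h|$, and $dx$ is the Riemannian volume measure. Write $f\in BD^k_{(s,r)}(M,\tilde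 M)$ if $\sigma_k(f)^{s}J_f^{-1}\in L^{r}(M)$. Let $L^p(M,\Lambda^k)$ be the space of differential $k$-forms $\theta$ on $M$ (up to equality almost everywhere) whose coefficients in every local coordinate system are locally integrable and for which $\|\theta\|_{L^p(M,\Lambda^k)}=\left(\int_M|\theta|^p\,dx\right)^{1/p}<\infty$, where $|\theta_x|$ is the norm induced by $g$ on $\Lambda^kT_x^*M$ (the forms $e^{i_1}\wedge\dots\wedge e^{i_k}$, $i_1<\dots<i_k$, are orthonormal if $(e^i)$ is dual to an orthonormal basis of $T_xM$). The quantity $\|\theta\|_{L^p(M,\Lambda^k)}\in[0,\infty]$ is used also when it is infinite. Then for every $\omega\in L^{\tilde p}(\tilde M,\Lambda^k)$ $$\|f^*\omega\|_{L^p(M,\Lambda^k)}\le\bigl(K_{\tilde p,t,k}(f)\bigr)^{1/\tilde p}\,\|\omega\|_{L^{\tilde p}(\tilde M,\Lambda^k)}$$ as elements of $[0,\infty]$, with $\infty\cdot 0=0$. In particular, if $f\in BD^k_{(\tilde p,t)}(M,\tilde M)$, then $f^*$ is a well-defined bounded linear operator $L^{\tilde p}(\tilde M,\Lambda^k)\to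 L^p(M,\Lambda^k)$. -/

import Mathlib

open MeasureTheory Module Bundle
open scoped Manifold ContDiff Bundle

noncomputable section

namespace DistortedForms

/-! ### Linear algebra of Euclidean vector spaces -/

section LinearAlgebra

variable {E F : Type*} [NormedAddCommGroup E] [InnerProductSpace ℝ E] [FiniteDimensional ℝ E]
  [NormedAddCommGroup F] [InnerProductSpace ℝ F] [FiniteDimensional ℝ F]

/-- The `k`-th principal invariant `σ_k(A)`: the `k`-th elementary symmetric polynomial in the
singular values `λ_0, …, λ_{n-1}` of `A`, where `n = dim E` (so `σ_0(A) = 1`). -/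
def principalInvariant (A : E →ₗ[ℝ] F) (k : ℕ) : ℝ :=
  ∑ s ∈ (Finset.range (finrank ℝ E)).powersetCard k, ∏ i ∈ s, A.singularValues i

/-- The Jacobian `J_A = σ_n(A) = λ_0 ⋯ λ_{n-1}`, where `n = dim E`. -/
def jacobian (A : E →ₗ[ℝ] F) : ℝ := principalInvariant A (finrank ℝ E)

/-- The Euclidean norm of an alternating `k`-form on a Euclidean space, for the scalar product in
which the forms `e^{i₁} ∧ ⋯ ∧ e^{i_k}`, `i₁ < ⋯ < i_k`, are orthonormal whenever `(e_i)` is an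
orthonormal basis:
`|α|² = ∑_{i₁ < ⋯ < i_k} α(e_{i₁}, …, e_{i_k})² = (1 / k!) ∑_{i₁, …, i_k} α(e_{i₁}, …, e_{i_k})²`.
It does not depend on the orthonormal basis. -/
def formNorm {k : ℕ} (α : E [⋀^Fin k]→L[ℝ] ℝ) : ℝ :=
  Real.sqrt ((k.factorial : ℝ)⁻¹ *
    ∑ v : Fin k → Fin (finrank ℝ E), α (fun i => stdOrthonormalBasis ℝ E (v i)) ^ 2)

end LinearAlgebra

/-! ### Coordinate vector fields and the Riemannian volume measure -/

section Manifold

variable {n : ℕ} {M : Type*} [TopologicalSpace M] [ChartedSpace (EuclideanSpace ℝ (Fin n)) M]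

instance finiteDimensional_tangentSpace (x : M) : FiniteDimensional ℝ (TangentSpace (𝓡 n) x) :=
  inferInstanceAs (FiniteDimensional ℝ (EuclideanSpace ℝ (Fin n)))

/-- The coordinate vector `∂_j` of the chart `e`, at the point of `M` with coordinates `y`. -/
def coordVector (e : OpenPartialHomeomorph M (EuclideanSpace ℝ (Fin n)))
    (y : EuclideanSpace ℝ (Fin n)) (j : Fin n) : TangentSpace (𝓡 n) (e.symm y) :=
  mfderiv (𝓡 n) (𝓡 n) e.symm y (EuclideanSpace.single j (1 : ℝ) : EuclideanSpace ℝ (Fin n))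

/-- The measure `√(det (g(∂_i, ∂_j))) dy` of a chart `e`, as a measure on `M` that is concentrated
on the domain of `e`. -/
def chartVolume [MeasurableSpace M] [RiemannianBundle (fun x : M => TangentSpace (𝓡 n) x)]
    (e : OpenPartialHomeomorph M (EuclideanSpace ℝ (Fin n))) : Measure M :=
  ((volume.restrict e.target).withDensity fun y =>
    ENNReal.ofReal (Real.sqrt (Matrix.det
      (Matrix.of fun i j : Fin n => inner ℝ (coordVector e y i) (coordVector e y j))))).map e.symm

variable (n M) in
/-- The Riemannian volume measure: the measures of the smooth charts agree on overlaps, and the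
volume is the measure glued from them, that is, their least upper bound among the measures
on `M`. -/
def riemannianVolume [MeasurableSpace M]
    [RiemannianBundle (fun x : M => TangentSpace (𝓡 n) x)] : Measure M :=
  ⨆ e ∈ IsManifold.maximalAtlas (𝓡 n) ∞ M, chartVolume e

/-! ### Differential forms and their Lebesgue spaces -/

variable (n M) in
/-- Differential `k`-forms on `M`, with no regularity. -/
abbrev DiffForm (k : ℕ) : Type _ := (x : M) → (TangentSpace (𝓡 n) x) [⋀^Fin k]→L[ℝ] ℝ

/-- `θ ∈ L¹_loc(M, Λᵏ)`: the coefficients of `θ` in every smooth local coordinate system are locally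
integrable. -/
def LocIntegrable {k : ℕ} (θ : DiffForm n M k) : Prop :=
  ∀ e ∈ IsManifold.maximalAtlas (𝓡 n) ∞ M, ∀ v : Fin k → Fin n,
    LocallyIntegrableOn (fun y => θ (e.symm y) fun i => coordVector e y (v i)) e.target volume

/-- `‖θ‖_{L^p(M, Λᵏ)} = (∫_M |θ|^p dx)^{1/p}`, possibly infinite. -/
def lpNorm [MeasurableSpace M] [RiemannianBundle (fun x : M => TangentSpace (𝓡 n) x)] {k : ℕ}
    (p : ℝ) (θ : DiffForm n M k) : ENNReal :=
  eLpNorm (fun x => formNorm (θ x)) (ENNReal.ofReal p) (riemannianVolume n M)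

/-- `θ ∈ L^p(M, Λᵏ)` (for a representative `θ`; forms that agree almost everywhere are identified in
`L^p(M, Λᵏ)`). -/
def MemLpForm [MeasurableSpace M] [RiemannianBundle (fun x : M => TangentSpace (𝓡 n) x)] {k : ℕ}
    (p : ℝ) (θ : DiffForm n M k) : Prop :=
  LocIntegrable θ ∧ lpNorm p θ < ⊤

end Manifold

/-! ### Pullback and distortion -/

section Maps

variable {n : ℕ}
  {M : Type*} [TopologicalSpace M] [ChartedSpace (EuclideanSpace ℝ (Fin n)) M]
  {N : Type*} [TopologicalSpace N] [ChartedSpace (EuclideanSpace ℝ (Fin n)) N]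

/-- The pullback of forms, `(f^*θ)_x (v₁, …, v_k) = θ_{f(x)} (df_x v₁, …, df_x v_k)`. -/
def pullback (f : M ≃ₘ⟮𝓡 n, 𝓡 n⟯ N) (k : ℕ) : DiffForm n N k →ₗ[ℝ] DiffForm n M k where
  toFun θ x := (θ (f x)).compContinuousLinearMap (mfderiv (𝓡 n) (𝓡 n) f x)
  map_add' _ _ := rfl
  map_smul' _ _ := rfl

/-- A linear map on forms induces a bounded operator `L^q(N, Λᵏ) → L^p(M, Λᵏ)`: it respects
almost everywhere equality, maps `L^q` to `L^p`, and is bounded for the norms. -/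
structure InducesBoundedOperator [MeasurableSpace M] [MeasurableSpace N]
    [RiemannianBundle (fun x : M => TangentSpace (𝓡 n) x)]
    [RiemannianBundle (fun x : N => TangentSpace (𝓡 n) x)] {k : ℕ}
    (q p : ℝ) (T : DiffForm n N k →ₗ[ℝ] DiffForm n M k) : Prop where
  congr_ae : ∀ θ η : DiffForm n N k, MemLpForm q θ → MemLpForm q η →
    (∀ᵐ y ∂(riemannianVolume n N), θ y = η y) → ∀ᵐ x ∂(riemannianVolume n M), T θ x = T η x
  memLp : ∀ θ : DiffForm n N k, MemLpForm q θ → MemLpForm p (T θ)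
  bound : ∃ C : NNReal, ∀ θ : DiffForm n N k, MemLpForm q θ → lpNorm p (T θ) ≤ C * lpNorm q θ

variable [RiemannianBundle (fun x : M => TangentSpace (𝓡 n) x)]
  [RiemannianBundle (fun x : N => TangentSpace (𝓡 n) x)]

/-- The function `x ↦ σ_k(f, x)^s / J_f(x)` on `M`. -/
def distortion (f : M ≃ₘ⟮𝓡 n, 𝓡 n⟯ N) (s : ℝ) (k : ℕ) (x : M) : ℝ :=
  principalInvariant (mfderiv (𝓡 n) (𝓡 n) f x).toLinearMap k ^ s /
    jacobian (mfderiv (𝓡 n) (𝓡 n) f x).toLinearMap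

/-- `K_{s,t,k}(f) = ‖σ_k(f)^s / J_f‖_{L^t(M)}`, for `t ∈ (0, ∞]`; possibly infinite. -/
def distortionNorm [MeasurableSpace M] (f : M ≃ₘ⟮𝓡 n, 𝓡 n⟯ N) (s : ℝ) (t : ENNReal) (k : ℕ) :
    ENNReal :=
  eLpNorm (distortion f s k) t (riemannianVolume n M)

/-- `f ∈ BD^k_{(s,t)}(M, N)`: the function `σ_k(f)^s / J_f` belongs to `L^t(M)`. -/
def BoundedDistortion [MeasurableSpace M] (f : M ≃ₘ⟮𝓡 n, 𝓡 n⟯ N) (s : ℝ) (t : ENNReal)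
    (k : ℕ) : Prop :=
  MemLp (distortion f s k) t (riemannianVolume n M)

end Maps

end DistortedForms

end

/-! Write `A` for the differential `df_x`, and `q` for the larger exponent. In an orthonormal
eigenbasis `e_i` of `A† A` one has `A e_i = λ_i u_i` with `u_i` orthonormal, so pulling back
multiplies the component of a form at `i₁, …, i_k` by `λ_{i₁} ⋯ λ_{i_k}`. Hence `|f^*θ| ≤ m · |θ| ∘
f`, where `m²` is the `k`-th elementary symmetric polynomial in the `λ_i²`
(`formNorm_compContinuousLinearMap_le`). Since `m ≤ σ_k`, this gives `m^q ≤ D J_f` with `D = σ_k^q /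
J_f`.

For `p < q`, Hölder's inequality with exponents `q / (q - p)` and `q / p`, applied to `(m^p
J_f^{-p/q}) · (J_f^{p/q} |θ ∘ f|^p)`, bounds `‖f^*θ‖_p` by `‖D‖_t^{1/q}` times `(∫ J_f |θ ∘
f|^q)^{1/q}`; for `p = q` the essential supremum of `D` is pulled out instead
(`lintegral_rpow_le_of_le_mul`). The change of variables `f_*(J_f dx) ≤ dy` concludes; only this
inequality is needed.

Measurability is required of `m` and `J_f` alone. Both are continuous, because in a chart `m²` is,
up to sign, a characteristic polynomial coefficient of `G⁻¹ H`, with `G` and `H` the Gram matrices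
of the coordinate frame and of its image. The form and `D` are handled by lower integrals. -/

noncomputable section

namespace DistortedForms

/-! ### Alternating forms in orthonormal bases -/

section Combinatorics

variable {ι : Type*} [Fintype ι] [DecidableEq ι] {R : Type*} [CommSemiring R]

/-- There are `k!` enumerations of a finite set with `k` elements. -/
theorem card_injective_image_eq {k : ℕ} {s : Finset ι} (hs : s.card = k) :
    (Finset.univ.filter fun v : Fin k → ι =>
      Function.Injective v ∧ Finset.univ.image v = s).card = k.factorial := by
  have e : {v : Fin k → ι // Function.Injective v ∧ Finset.univ.image v = s} ≃
      (Fin k ↪ s) :=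
    { toFun := fun v => ⟨fun i => ⟨v.1 i, by
          have h := Finset.mem_image_of_mem v.1 (Finset.mem_univ i)
          rwa [v.2.2] at h⟩,
        fun i j hij => v.2.1 (congrArg Subtype.val hij)⟩
      invFun := fun w => ⟨fun i => (w i : ι), fun i j hij => w.injective (Subtype.ext hij), by
        refine Finset.eq_of_subset_of_card_le ?_ ?_
        · intro x hx
          obtain ⟨i, -, rfl⟩ := Finset.mem_image.1 hx
          exact (w i).2
        · rw [Finset.card_image_of_injective _
            (fun i j hij => w.injective (Subtype.ext hij) : Function.Injective fun i => (w i : ι))]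
          simp [hs]⟩
      left_inv := fun v => rfl
      right_inv := fun w => rfl }
  rw [← Fintype.card_subtype, Fintype.card_congr e, Fintype.card_embedding_eq]
  simp [hs, Nat.descFactorial_self]

/-- Summing a monomial over injective `k`-tuples of indices gives `k!` times the `k`-th elementary
symmetric polynomial. -/
theorem sum_injective_prod (x : ι → R) (k : ℕ) :
    ∑ v ∈ Finset.univ.filter (fun v : Fin k → ι => Function.Injective v), ∏ i, x (v i) =
      k.factorial * ∑ s ∈ (Finset.univ : Finset ι).powersetCard k, ∏ i ∈ s, x i := by
  rw [← Finset.sum_fiberwise_of_maps_to (t := (Finset.univ : Finset ι).powersetCard k)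
    (g := fun v => Finset.univ.image v), Finset.mul_sum]
  · refine Finset.sum_congr rfl fun s hs => ?_
    rw [Finset.mem_powersetCard] at hs
    rw [Finset.filter_filter, ← card_injective_image_eq hs.2, ← nsmul_eq_mul]
    refine Finset.sum_eq_card_nsmul fun v hv => ?_
    rw [Finset.mem_filter] at hv
    rw [← hv.2.2, Finset.prod_image fun i _ j _ h => hv.2.1 h]
  · intro v hv
    rw [Finset.mem_filter] at hv
    rw [Finset.mem_powersetCard]
    exact ⟨Finset.subset_univ _, by rw [Finset.card_image_of_injective _ hv.2]; simp⟩

end Combinatorics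

section LinearAlgebra

variable {E F : Type*} [NormedAddCommGroup E] [InnerProductSpace ℝ E]
  [NormedAddCommGroup F] [InnerProductSpace ℝ F]
  {ι κ : Type*} [Fintype ι] [Fintype κ] {k : ℕ}

/-- The sum of the squares of the components of a form in an orthonormal basis does not depend on
the basis. -/
theorem sum_sq_apply_orthonormalBasis (α : E [⋀^Fin k]→L[ℝ] ℝ) (b : OrthonormalBasis ι ℝ E)
    (c : OrthonormalBasis κ ℝ E) :
    ∑ v : Fin k → ι, α (fun i => b (v i)) ^ 2 = ∑ w : Fin k → κ, α (fun i => c (w i)) ^ 2 := by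
  classical
  have hexp : ∀ v : Fin k → ι, α (fun i => b (v i)) =
      ∑ w : Fin k → κ, (∏ i, inner ℝ (c (w i)) (b (v i))) * α (fun i => c (w i)) := by
    intro v
    have h1 : (fun i => b (v i)) = fun i => ∑ j, inner ℝ (c j) (b (v i)) • c j := by
      funext i
      exact (c.sum_repr' (b (v i))).symm
    rw [h1]
    refine (α.toMultilinearMap.map_sum (fun i j => inner ℝ (c j) (b (v i)) • c j)).trans ?_
    refine Finset.sum_congr rfl fun w _ => ?_
    exact α.toMultilinearMap.map_smul_univ (fun i => inner ℝ (c (w i)) (b (v i)))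
      (fun i => c (w i))
  -- The sum over all tuples `v` factors into one sum per slot, and each factor is a Kronecker delta
  -- by Parseval's identity for `b`.
  have hort : ∀ w w' : Fin k → κ,
      ∑ v : Fin k → ι, (∏ i, inner ℝ (c (w i)) (b (v i))) * ∏ i, inner ℝ (c (w' i)) (b (v i)) =
        if w = w' then (1 : ℝ) else 0 := by
    intro w w'
    simp_rw [← Finset.prod_mul_distrib]
    have h2 := (Finset.prod_univ_sum (fun _ : Fin k => (Finset.univ : Finset ι))
      (fun i j => inner ℝ (c (w i)) (b j) * inner ℝ (c (w' i)) (b j))).symm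
    rw [Fintype.piFinset_univ] at h2
    rw [h2]
    have h3 : ∀ i, ∑ j, inner ℝ (c (w i)) (b j) * inner ℝ (c (w' i)) (b j) =
        if w i = w' i then (1 : ℝ) else 0 := by
      intro i
      have : ∀ j, inner ℝ (c (w' i)) (b j) = inner ℝ (b j) (c (w' i)) :=
        fun j => real_inner_comm _ _
      simp_rw [this]
      rw [b.sum_inner_mul_inner, orthonormal_iff_ite.1 c.orthonormal]
    simp_rw [h3]
    by_cases h : w = w'
    · simp [h]
    · rw [if_neg h]
      obtain ⟨i, hi⟩ := Function.ne_iff.1 h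
      exact Finset.prod_eq_zero (Finset.mem_univ i) (if_neg hi)
  calc ∑ v : Fin k → ι, α (fun i => b (v i)) ^ 2
      = ∑ v : Fin k → ι, ∑ w : Fin k → κ, ∑ w' : Fin k → κ,
          (α (fun i => c (w i)) * α (fun i => c (w' i))) *
          ((∏ i, inner ℝ (c (w i)) (b (v i))) * ∏ i, inner ℝ (c (w' i)) (b (v i))) := by
        refine Finset.sum_congr rfl fun v _ => ?_
        rw [hexp v, sq, Finset.sum_mul_sum]
        refine Finset.sum_congr rfl fun w _ => Finset.sum_congr rfl fun w' _ => ?_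
        ring
    _ = ∑ w : Fin k → κ, ∑ w' : Fin k → κ, (α (fun i => c (w i)) * α (fun i => c (w' i))) *
          if w = w' then (1 : ℝ) else 0 := by
        rw [Finset.sum_comm]
        refine Finset.sum_congr rfl fun w _ => ?_
        rw [Finset.sum_comm]
        refine Finset.sum_congr rfl fun w' _ => ?_
        rw [← Finset.mul_sum, hort]
    _ = ∑ w : Fin k → κ, α (fun i => c (w i)) ^ 2 := by
        refine Finset.sum_congr rfl fun w _ => ?_
        simp [sq]

variable [FiniteDimensional ℝ E] [FiniteDimensional ℝ F]

theorem formNorm_nonneg (α : E [⋀^Fin k]→L[ℝ] ℝ) : 0 ≤ formNorm α := Real.sqrt_nonneg _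

theorem formNorm_sq (α : E [⋀^Fin k]→L[ℝ] ℝ) (b : OrthonormalBasis ι ℝ E) :
    formNorm α ^ 2 = (k.factorial : ℝ)⁻¹ * ∑ v : Fin k → ι, α (fun i => b (v i)) ^ 2 := by
  rw [formNorm, Real.sq_sqrt (by positivity),
    sum_sq_apply_orthonormalBasis α (stdOrthonormalBasis ℝ E) b]

/-- The components of a form in an orthonormal basis are bounded by its norm. -/
theorem sq_apply_le_formNorm_sq (α : E [⋀^Fin k]→L[ℝ] ℝ) (b : OrthonormalBasis ι ℝ E)
    {v : Fin k → ι} (hv : Function.Injective v) :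
    α (fun i => b (v i)) ^ 2 ≤ formNorm α ^ 2 := by
  classical
  rw [formNorm_sq α b, inv_mul_eq_div, le_div_iff₀ (by positivity)]
  -- The `k!` rearrangements of `v` are distinct tuples with the same squared component; they absorb
  -- the factor `1 / k!` in the norm.
  have hinj : Function.Injective fun (σ : Equiv.Perm (Fin k)) (i : Fin k) => v (σ i) := by
    intro σ τ h
    ext i
    exact congrArg Fin.val (hv (congrFun h i))
  calc α (fun i => b (v i)) ^ 2 * k.factorial
      = ∑ σ : Equiv.Perm (Fin k), α (fun i => b (v (σ i))) ^ 2 := by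
        have : ∀ σ : Equiv.Perm (Fin k),
            α (fun i => b (v (σ i))) ^ 2 = α (fun i => b (v i)) ^ 2 := by
          intro σ
          have h := α.toAlternatingMap.map_perm (fun i => b (v i)) σ
          have h' : α (fun i => b (v (σ i))) = Equiv.Perm.sign σ • α (fun i => b (v i)) := h
          rw [h']
          rcases Int.units_eq_one_or (Equiv.Perm.sign σ) with hs | hs <;> simp [hs]
        simp_rw [this]
        simp [Fintype.card_perm, mul_comm]
    _ = ∑ w ∈ Finset.univ.image fun (σ : Equiv.Perm (Fin k)) (i : Fin k) => v (σ i),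
          α (fun i => b (w i)) ^ 2 := by
        rw [Finset.sum_image fun _ _ _ _ h => hinj h]
    _ ≤ ∑ w : Fin k → ι, α (fun i => b (w i)) ^ 2 :=
        Finset.sum_le_sum_of_subset_of_nonneg (Finset.subset_univ _) fun _ _ _ => sq_nonneg _

/-! ### Invariants of `A† A` -/

/-- The `k`-th elementary symmetric polynomial in the squares of the singular values. -/
def sqInvariant (A : E →ₗ[ℝ] F) (k : ℕ) : ℝ :=
  ∑ s ∈ (Finset.univ : Finset (Fin (finrank ℝ E))).powersetCard k,
    ∏ i ∈ s, A.singularValues i ^ 2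

theorem sqInvariant_nonneg (A : E →ₗ[ℝ] F) (k : ℕ) : 0 ≤ sqInvariant A k :=
  Finset.sum_nonneg fun _ _ => Finset.prod_nonneg fun _ _ => sq_nonneg _

theorem principalInvariant_eq_sum_fin (A : E →ₗ[ℝ] F) (k : ℕ) :
    principalInvariant A k = ∑ s ∈ (Finset.univ : Finset (Fin (finrank ℝ E))).powersetCard k,
      ∏ i ∈ s, A.singularValues i := by
  have h : Finset.range (finrank ℝ E) =
      (Finset.univ : Finset (Fin (finrank ℝ E))).map Fin.valEmbedding := by
    ext i
    simp only [Finset.mem_range, Finset.mem_map, Finset.mem_univ, true_and]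
    exact ⟨fun hi => ⟨⟨i, hi⟩, rfl⟩, by rintro ⟨j, rfl⟩; exact j.2⟩
  rw [principalInvariant, h, Finset.powersetCard_map, Finset.sum_map]
  refine Finset.sum_congr rfl fun s _ => ?_
  exact Finset.prod_map _ _ _

theorem principalInvariant_nonneg (A : E →ₗ[ℝ] F) (k : ℕ) : 0 ≤ principalInvariant A k :=
  Finset.sum_nonneg fun _ _ => Finset.prod_nonneg fun _ _ => A.singularValues_nonneg _

/-- A sum of squares of nonnegative numbers is at most the square of their sum. This is where the
sharper multiplier `m` is traded for `σ_k`. -/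
theorem sqrt_sqInvariant_le_principalInvariant (A : E →ₗ[ℝ] F) (k : ℕ) :
    Real.sqrt (sqInvariant A k) ≤ principalInvariant A k := by
  refine Real.sqrt_le_iff.2 ⟨principalInvariant_nonneg A k, ?_⟩
  rw [principalInvariant_eq_sum_fin, sqInvariant]
  simp_rw [Finset.prod_pow]
  exact Finset.sum_sq_le_sq_sum_of_nonneg fun s _ =>
    Finset.prod_nonneg fun _ _ => A.singularValues_nonneg _

theorem jacobian_eq_prod (A : E →ₗ[ℝ] F) :
    jacobian A = ∏ i : Fin (finrank ℝ E), A.singularValues i := by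
  rw [jacobian, principalInvariant_eq_sum_fin]
  have h : (Finset.univ : Finset (Fin (finrank ℝ E))).powersetCard (finrank ℝ E) =
      {Finset.univ} := by
    have h' := Finset.powersetCard_self (Finset.univ : Finset (Fin (finrank ℝ E)))
    rwa [Finset.card_fin] at h'
  rw [h, Finset.sum_singleton]

theorem jacobian_nonneg (A : E →ₗ[ℝ] F) : 0 ≤ jacobian A := principalInvariant_nonneg A _

theorem jacobian_pos {A : E →ₗ[ℝ] F} (hA : Function.Injective A) : 0 < jacobian A := by
  rw [jacobian_eq_prod]
  exact Finset.prod_pos fun i _ =>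
    A.injective_iff_forall_lt_finrank_singularValues_pos.1 hA i i.2

theorem jacobian_sq_eq_det (A : E →ₗ[ℝ] F) :
    jacobian A ^ 2 = LinearMap.det (A.adjoint ∘ₗ A) := by
  rw [jacobian_eq_prod, A.isSymmetric_adjoint_comp_self.det_eq_prod_eigenvalues rfl,
    ← Finset.prod_pow]
  refine Finset.prod_congr rfl fun i _ => ?_
  rw [A.sq_singularValues_fin rfl]
  rfl

theorem jacobian_sq_eq_sqInvariant (A : E →ₗ[ℝ] F) :
    jacobian A ^ 2 = sqInvariant A (finrank ℝ E) := by
  have h := Finset.powersetCard_self (Finset.univ : Finset (Fin (finrank ℝ E)))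
  rw [Finset.card_fin] at h
  rw [jacobian_eq_prod, sqInvariant, h, Finset.sum_singleton, Finset.prod_pow]

/-- Vieta's formula for the eigenvalues `λ_i²` of `A† A`. It gives continuity in `A` without
following individual eigenvalues. -/
theorem sqInvariant_eq_coeff_charpoly (A : E →ₗ[ℝ] F) {k : ℕ} (hk : k ≤ finrank ℝ E) :
    sqInvariant A k = (-1) ^ k * (A.adjoint ∘ₗ A).charpoly.coeff (finrank ℝ E - k) := by
  have hcard : (Finset.univ : Finset (Fin (finrank ℝ E))).card = finrank ℝ E := Finset.card_fin _
  rw [A.isSymmetric_adjoint_comp_self.charpoly_eq rfl]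
  simp_rw [sub_eq_add_neg, ← map_neg Polynomial.C]
  rw [Finset.prod_X_add_C_coeff _ _ (by rw [hcard]; omega), hcard,
    Nat.sub_sub_self hk, sqInvariant, Finset.mul_sum]
  refine Finset.sum_congr rfl fun s hs => ?_
  rw [Finset.prod_neg, (Finset.mem_powersetCard.1 hs).2, ← mul_assoc, ← mul_pow]
  simp only [mul_neg, mul_one, neg_neg, one_pow, one_mul]
  refine Finset.prod_congr rfl fun i _ => ?_
  rw [A.sq_singularValues_fin rfl]
  rfl

theorem sqInvariant_of_lt (A : E →ₗ[ℝ] F) {k : ℕ} (hk : finrank ℝ E < k) :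
    sqInvariant A k = 0 := by
  rw [sqInvariant, Finset.powersetCard_eq_empty.2 (by simpa using hk), Finset.sum_empty]

/-- The matrix of `A† A` in a basis is `G⁻¹ H`, where `G` and `H` are the Gram matrices of the basis
and of its image under `A`. -/
theorem toMatrix_adjoint_comp_self [DecidableEq ι] (A : E →ₗ[ℝ] F) (b : Basis ι ℝ E) :
    LinearMap.toMatrix b b (A.adjoint ∘ₗ A) =
      (Matrix.gram ℝ b)⁻¹ * Matrix.gram ℝ (fun i => A (b i)) := by
  have hdet : IsUnit (Matrix.gram ℝ b).det :=
    (Matrix.det_gram_ne_zero_iff_linearIndependent.2 b.linearIndependent).isUnit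
  have h : Matrix.gram ℝ (fun i => A (b i)) =
      Matrix.gram ℝ b * LinearMap.toMatrix b b (A.adjoint ∘ₗ A) := by
    ext i j
    rw [Matrix.gram_apply, Matrix.mul_apply, ← LinearMap.adjoint_inner_right]
    conv_lhs => rw [← LinearMap.comp_apply, ← b.sum_repr ((A.adjoint ∘ₗ A) (b j)), inner_sum]
    refine Finset.sum_congr rfl fun l _ => ?_
    rw [inner_smul_right, Matrix.gram_apply, LinearMap.toMatrix_apply, mul_comm]
  rw [h, Matrix.nonsing_inv_mul_cancel_left _ _ hdet]

/-- Take determinants in the matrix `G⁻¹ H` of `A† A`, whose determinant is `J_A²`. This is the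
transformation law of the Riemannian volume density. -/
theorem sqrt_det_gram_map [DecidableEq ι] (A : E →ₗ[ℝ] F) (b : Basis ι ℝ E) :
    Real.sqrt (Matrix.gram ℝ (fun i => A (b i))).det =
      jacobian A * Real.sqrt (Matrix.gram ℝ b).det := by
  have hdet : (Matrix.gram ℝ b).det ≠ 0 :=
    Matrix.det_gram_ne_zero_iff_linearIndependent.2 b.linearIndependent
  have h : (Matrix.gram ℝ (fun i => A (b i))).det = jacobian A ^ 2 * (Matrix.gram ℝ b).det := by
    rw [jacobian_sq_eq_det, ← LinearMap.det_toMatrix b, toMatrix_adjoint_comp_self,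
      Matrix.det_mul, Matrix.det_nonsing_inv, Ring.inverse_eq_inv']
    field_simp
  rw [h, Real.sqrt_mul (sq_nonneg _), Real.sqrt_sq (jacobian_nonneg A)]

/-- A form pulled back by an injective map between spaces of the same dimension. -/
theorem formNorm_compContinuousLinearMap_le (A : E →L[ℝ] F) (hA : Function.Injective A)
    (hdim : finrank ℝ E = finrank ℝ F) (α : F [⋀^Fin k]→L[ℝ] ℝ) :
    formNorm (α.compContinuousLinearMap A) ≤
      Real.sqrt (sqInvariant A.toLinearMap k) * formNorm α := by
  classical
  set T : E →ₗ[ℝ] F := A.toLinearMap with hT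
  set e := T.isSymmetric_adjoint_comp_self.eigenvectorBasis rfl with he
  have hpos : ∀ i : Fin (finrank ℝ E), 0 < T.singularValues i := fun i =>
    T.injective_iff_forall_lt_finrank_singularValues_pos.1 hA i i.2
  have hinner : ∀ i j, inner ℝ (T (e i)) (T (e j)) =
      if i = j then T.singularValues i ^ 2 else 0 := by
    intro i j
    rw [← LinearMap.adjoint_inner_right]
    have h := T.isSymmetric_adjoint_comp_self.apply_eigenvectorBasis rfl j
    rw [LinearMap.comp_apply] at h
    rw [he, h, inner_smul_right, orthonormal_iff_ite.1 (OrthonormalBasis.orthonormal _),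
      T.sq_singularValues_fin rfl]
    split_ifs with hij
    · subst hij; simp
    · simp
  -- The images of the eigenvectors are orthogonal with lengths `λ_i > 0`; once normalised they form
  -- a basis of `F` because the dimensions agree.
  have hu : Orthonormal ℝ fun i : Fin (finrank ℝ E) => (T.singularValues i)⁻¹ • T (e i) := by
    rw [orthonormal_iff_ite]
    intro i j
    rw [inner_smul_left, inner_smul_right, hinner]
    split_ifs with hij
    · subst hij
      have := (hpos i).ne'
      simp only [conj_trivial]
      field_simp
    · simp
  have hcard : Fintype.card (Fin (finrank ℝ E)) = finrank ℝ F := by simpa using hdim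
  obtain ⟨u, hu'⟩ : ∃ u : OrthonormalBasis (Fin (finrank ℝ E)) ℝ F,
      ∀ i, T (e i) = T.singularValues i • u i := by
    refine ⟨OrthonormalBasis.mk hu
      (hu.linearIndependent.span_eq_top_of_card_eq_finrank' hcard).ge, fun i => ?_⟩
    rw [OrthonormalBasis.coe_mk, smul_inv_smul₀ (hpos i).ne']
  have hcomp : ∀ v : Fin k → Fin (finrank ℝ E),
      (α.compContinuousLinearMap A) (fun i => e (v i)) =
        (∏ i, T.singularValues (v i)) * α (fun i => u (v i)) := by
    intro v
    have h1 : (α.compContinuousLinearMap A) (fun i => e (v i)) =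
        α (fun i => T.singularValues (v i) • u (v i)) := by
      simp_rw [← hu']
      rfl
    rw [h1]
    exact α.toMultilinearMap.map_smul_univ (fun i => T.singularValues (v i)) (fun i => u (v i))
  -- Tuples with a repeated index contribute zero, so the remaining sum is `k!` times an elementary
  -- symmetric polynomial.
  have hbound : ∀ v : Fin k → Fin (finrank ℝ E),
      (α.compContinuousLinearMap A) (fun i => e (v i)) ^ 2 ≤
        if Function.Injective v then (∏ i, T.singularValues (v i) ^ 2) * formNorm α ^ 2
        else 0 := by
    intro v
    rw [hcomp, mul_pow, ← Finset.prod_pow]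
    split_ifs with hv
    · exact mul_le_mul_of_nonneg_left (sq_apply_le_formNorm_sq α u hv)
        (Finset.prod_nonneg fun _ _ => sq_nonneg _)
    · have h0 : α (fun i => u (v i)) = 0 := by
        rw [Function.not_injective_iff] at hv
        obtain ⟨i, j, hij, hne⟩ := hv
        exact α.map_eq_zero_of_eq _ (by simp [hij]) hne
      simp [h0]
  have hfac : (k.factorial : ℝ) ≠ 0 := by positivity
  refine le_of_sq_le_sq ?_ (mul_nonneg (Real.sqrt_nonneg _) (formNorm_nonneg _))
  rw [mul_pow, Real.sq_sqrt (sqInvariant_nonneg _ _), formNorm_sq _ e]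
  calc (k.factorial : ℝ)⁻¹ * ∑ v : Fin k → Fin (finrank ℝ E),
        (α.compContinuousLinearMap A) (fun i => e (v i)) ^ 2
      ≤ (k.factorial : ℝ)⁻¹ * ∑ v : Fin k → Fin (finrank ℝ E),
          if Function.Injective v then (∏ i, T.singularValues (v i) ^ 2) * formNorm α ^ 2
          else 0 := by
        gcongr with v
        exact hbound v
    _ = sqInvariant T k * formNorm α ^ 2 := by
        rw [← Finset.sum_filter, ← Finset.sum_mul,
          sum_injective_prod (fun i : Fin (finrank ℝ E) => T.singularValues i ^ 2) k,
          ← sqInvariant]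
        field_simp

end LinearAlgebra

/-- Each coefficient is a polynomial in the matrix entries, read off from the universal
characteristic polynomial. -/
theorem continuous_coeff_charpoly {ι : Type*} [Fintype ι] [DecidableEq ι] (i : ℕ) :
    Continuous fun A : Matrix ι ι ℝ => A.charpoly.coeff i := by
  have h : (fun A : Matrix ι ι ℝ => A.charpoly.coeff i) = fun A =>
      MvPolynomial.eval (fun p : ι × ι => A p.1 p.2) ((Matrix.charpoly.univ ℝ ι).coeff i) := by
    funext A
    exact (Matrix.charpoly.univ_coeff_eval₂Hom ι (RingHom.id ℝ) (fun p => A p.1 p.2) i).symm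
  rw [h]
  exact (MvPolynomial.continuous_eval _).comp (by fun_prop)

/-! ### Charts: coordinate frames, transport along a diffeomorphism, measurability -/

section Coordinates

variable {n : ℕ} {M : Type*} [TopologicalSpace M] [ChartedSpace (EuclideanSpace ℝ (Fin n)) M]

theorem mdifferentiable_of_mem_maximalAtlas
    {e : OpenPartialHomeomorph M (EuclideanSpace ℝ (Fin n))}
    (he : e ∈ IsManifold.maximalAtlas (𝓡 n) ∞ M) : e.MDifferentiable (𝓡 n) (𝓡 n) :=
  ⟨(contMDiffOn_of_mem_maximalAtlas he).mdifferentiableOn (by simp),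
    (contMDiffOn_symm_of_mem_maximalAtlas he).mdifferentiableOn (by simp)⟩

/-- The coordinate vectors of a chart as a basis of the tangent space. -/
def coordBasis {e : OpenPartialHomeomorph M (EuclideanSpace ℝ (Fin n))}
    (he : e ∈ IsManifold.maximalAtlas (𝓡 n) ∞ M) {y : EuclideanSpace ℝ (Fin n)}
    (hy : y ∈ e.target) : Basis (Fin n) ℝ (TangentSpace (𝓡 n) (e.symm y)) :=
  (EuclideanSpace.basisFun (Fin n) ℝ).toBasis.map
    ((mdifferentiable_of_mem_maximalAtlas he).symm.mfderiv (x := y) hy).toLinearEquiv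

theorem coordBasis_apply {e : OpenPartialHomeomorph M (EuclideanSpace ℝ (Fin n))}
    (he : e ∈ IsManifold.maximalAtlas (𝓡 n) ∞ M) {y : EuclideanSpace ℝ (Fin n)}
    (hy : y ∈ e.target) (j : Fin n) : coordBasis he hy j = coordVector e y j := by
  refine (Basis.map_apply (EuclideanSpace.basisFun (Fin n) ℝ).toBasis
    ((mdifferentiable_of_mem_maximalAtlas he).symm.mfderiv (x := y) hy).toLinearEquiv j).trans ?_
  rw [OrthonormalBasis.coe_toBasis, EuclideanSpace.basisFun_apply]
  rfl

variable [IsManifold (𝓡 n) ∞ M]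

/-- The coordinate field is the tangent map of `e.symm` applied to a constant section of the trivial
tangent bundle of the model space. -/
theorem continuousOn_coordVector {e : OpenPartialHomeomorph M (EuclideanSpace ℝ (Fin n))}
    (he : e ∈ IsManifold.maximalAtlas (𝓡 n) ∞ M) (j : Fin n) :
    ContinuousOn (fun y => (⟨e.symm y, coordVector e y j⟩ : TangentBundle (𝓡 n) M)) e.target := by
  have : IsManifold (𝓡 n) 1 M := IsManifold.of_le (n := ∞) (by simp)
  have h1 := (contMDiffOn_symm_of_mem_maximalAtlas he).continuousOn_tangentMapWithin
    (by simp) e.open_target.uniqueMDiffOn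
  have h2 : Continuous fun y : EuclideanSpace ℝ (Fin n) =>
      (⟨y, EuclideanSpace.single j (1 : ℝ)⟩ :
        TangentBundle (𝓡 n) (EuclideanSpace ℝ (Fin n))) :=
    (tangentBundleModelSpaceHomeomorph (𝓡 n)).symm.continuous.comp
      (continuous_id.prodMk continuous_const)
  refine (h1.comp h2.continuousOn fun y hy => hy).congr fun y hy => ?_
  have h3 := tangentMapWithin_eq_tangentMap (I := 𝓡 n) (I' := 𝓡 n) (f := e.symm)
    (p := (⟨y, EuclideanSpace.single j (1 : ℝ)⟩ :
        TangentBundle (𝓡 n) (EuclideanSpace ℝ (Fin n))))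
    (e.open_target.uniqueMDiffOn y hy)
    ((mdifferentiable_of_mem_maximalAtlas he).symm.mdifferentiableAt hy)
  exact h3.symm

variable [RiemannianBundle (fun x : M => TangentSpace (𝓡 n) x)]
  [IsContMDiffRiemannianBundle (𝓡 n) ∞ (EuclideanSpace ℝ (Fin n))
    (fun x : M => TangentSpace (𝓡 n) x)]

theorem continuousOn_gram_coordVector {e : OpenPartialHomeomorph M (EuclideanSpace ℝ (Fin n))}
    (he : e ∈ IsManifold.maximalAtlas (𝓡 n) ∞ M) :
    ContinuousOn (fun y => Matrix.gram ℝ (coordVector e y)) e.target := by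
  have : IsContinuousRiemannianBundle (EuclideanSpace ℝ (Fin n))
      (fun x : M => TangentSpace (𝓡 n) x) := by
    obtain ⟨g, hg, hg'⟩ := IsContMDiffRiemannianBundle.exists_contMDiff (IB := 𝓡 n) (n := ∞)
      (F := EuclideanSpace ℝ (Fin n)) (E := fun x : M => TangentSpace (𝓡 n) x)
    exact ⟨g, hg.continuous, hg'⟩
  refine continuousOn_pi.2 fun i => continuousOn_pi.2 fun j => ?_
  exact (continuousOn_coordVector he i).inner_bundle (continuousOn_coordVector he j)

end Coordinates

section Transport

variable {n : ℕ}
  {M : Type*} [TopologicalSpace M] [ChartedSpace (EuclideanSpace ℝ (Fin n)) M]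
  {N : Type*} [TopologicalSpace N] [ChartedSpace (EuclideanSpace ℝ (Fin n)) N]

/-- The chart `e ∘ f⁻¹` of `N` obtained from a chart `e` of `M`. -/
def transportChart (f : M ≃ₘ⟮𝓡 n, 𝓡 n⟯ N)
    (e : OpenPartialHomeomorph M (EuclideanSpace ℝ (Fin n))) :
    OpenPartialHomeomorph N (EuclideanSpace ℝ (Fin n)) :=
  f.symm.toHomeomorph.transOpenPartialHomeomorph e

theorem coordVector_transportChart (f : M ≃ₘ⟮𝓡 n, 𝓡 n⟯ N)
    {e : OpenPartialHomeomorph M (EuclideanSpace ℝ (Fin n))}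
    (he : e ∈ IsManifold.maximalAtlas (𝓡 n) ∞ M) {y : EuclideanSpace ℝ (Fin n)}
    (hy : y ∈ e.target) (j : Fin n) :
    coordVector (transportChart f e) y j =
      mfderiv (𝓡 n) (𝓡 n) f (e.symm y) (coordVector e y j) := by
  have h : mfderiv (𝓡 n) (𝓡 n) (f ∘ e.symm) y =
      (mfderiv (𝓡 n) (𝓡 n) f (e.symm y)).comp (mfderiv (𝓡 n) (𝓡 n) e.symm y) :=
    mfderiv_comp y (f.mdifferentiable (by simp) _)
      ((mdifferentiable_of_mem_maximalAtlas he).symm.mdifferentiableAt hy)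
  exact DFunLike.congr_fun h (EuclideanSpace.single j (1 : ℝ) : EuclideanSpace ℝ (Fin n))

theorem mfderiv_diffeomorph_injective (f : M ≃ₘ⟮𝓡 n, 𝓡 n⟯ N) (x : M) :
    Function.Injective (mfderiv (𝓡 n) (𝓡 n) f x) :=
  (f.mfderivToContinuousLinearEquiv (by simp) x).injective

theorem gram_transportChart [RiemannianBundle (fun x : N => TangentSpace (𝓡 n) x)]
    (f : M ≃ₘ⟮𝓡 n, 𝓡 n⟯ N)
    {e : OpenPartialHomeomorph M (EuclideanSpace ℝ (Fin n))}
    (he : e ∈ IsManifold.maximalAtlas (𝓡 n) ∞ M) {y : EuclideanSpace ℝ (Fin n)}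
    (hy : y ∈ e.target) :
    Matrix.gram ℝ (coordVector (transportChart f e) y) =
      Matrix.gram ℝ (fun i => (mfderiv (𝓡 n) (𝓡 n) f (e.symm y)).toLinearMap
        (coordBasis he hy i)) := by
  ext i j
  simp only [Matrix.gram_apply, coordBasis_apply]
  rw [coordVector_transportChart f he hy, coordVector_transportChart f he hy]
  rfl

variable [IsManifold (𝓡 n) ∞ M] [IsManifold (𝓡 n) ∞ N]

theorem transportChart_mem_maximalAtlas (f : M ≃ₘ⟮𝓡 n, 𝓡 n⟯ N)
    {e : OpenPartialHomeomorph M (EuclideanSpace ℝ (Fin n))}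
    (he : e ∈ IsManifold.maximalAtlas (𝓡 n) ∞ M) :
    transportChart f e ∈ IsManifold.maximalAtlas (𝓡 n) ∞ N := by
  rw [IsManifold.mem_maximalAtlas_iff_contMDiffOn] at he ⊢
  exact ⟨he.1.comp f.symm.contMDiff.contMDiffOn fun x hx => hx,
    f.contMDiff.comp_contMDiffOn he.2⟩

/-- Pulling back along a diffeomorphism preserves local integrability of the coefficients. -/
theorem LocIntegrable.pullback {k : ℕ} {θ : DiffForm n N k} (hθ : LocIntegrable θ)
    (f : M ≃ₘ⟮𝓡 n, 𝓡 n⟯ N) : LocIntegrable (pullback f k θ) := by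
  intro e he v y hy
  -- The coefficients of the pullback in `e` are those of `θ` in the transported chart, over the
  -- same coordinate domain, so no change of variables occurs.
  obtain ⟨s, hs, hi⟩ := hθ _ (transportChart_mem_maximalAtlas f he) v y hy
  refine ⟨s ∩ e.target, Filter.inter_mem hs self_mem_nhdsWithin,
    (hi.mono_set Set.inter_subset_left).congr ?_⟩
  filter_upwards [ae_mono (Measure.restrict_mono_set volume Set.inter_subset_right)
    (ae_restrict_mem e.open_target.measurableSet)] with z hz
  simp_rw [coordVector_transportChart f he hz]
  rfl

variable [RiemannianBundle (fun x : M => TangentSpace (𝓡 n) x)]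
  [IsContMDiffRiemannianBundle (𝓡 n) ∞ (EuclideanSpace ℝ (Fin n))
    (fun x : M => TangentSpace (𝓡 n) x)]
  [RiemannianBundle (fun x : N => TangentSpace (𝓡 n) x)]
  [IsContMDiffRiemannianBundle (𝓡 n) ∞ (EuclideanSpace ℝ (Fin n))
    (fun x : N => TangentSpace (𝓡 n) x)]

/-- Near a point, `A† A` has matrix `G⁻¹ H` in the coordinate frame, and `H` is the Gram matrix of
the transported chart's frame. Both matrices are continuous and `G` is invertible. -/
theorem continuous_sqInvariant_mfderiv (f : M ≃ₘ⟮𝓡 n, 𝓡 n⟯ N) (k : ℕ) :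
    Continuous fun x => sqInvariant (mfderiv (𝓡 n) (𝓡 n) f x).toLinearMap k := by
  have hfin : ∀ x : M, finrank ℝ (TangentSpace (𝓡 n) x) = n := fun x =>
    finrank_euclideanSpace_fin (𝕜 := ℝ) (n := n)
  -- For `k > n` the truncated `n - k` is `0` and would select the constant coefficient, whereas the
  -- invariant vanishes.
  by_cases hk : k ≤ n
  swap
  · have h : (fun x => sqInvariant (mfderiv (𝓡 n) (𝓡 n) f x).toLinearMap k) = fun _ => 0 := by
      funext x
      exact sqInvariant_of_lt _ (by rw [hfin]; omega)
    rw [h]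
    exact continuous_const
  rw [continuous_iff_continuousAt]
  intro x₀
  set e := chartAt (EuclideanSpace ℝ (Fin n)) x₀ with he_def
  have he : e ∈ IsManifold.maximalAtlas (𝓡 n) ∞ M := IsManifold.chart_mem_maximalAtlas x₀
  have hG := continuousOn_gram_coordVector he
  have hH : ContinuousOn (fun y => Matrix.gram ℝ (coordVector (transportChart f e) y)) e.target :=
    continuousOn_gram_coordVector (transportChart_mem_maximalAtlas f he)
  have hdet : ∀ y ∈ e.target, (Matrix.gram ℝ (coordVector e y)).det ≠ 0 := by
    intro y hy
    have h := Matrix.det_gram_ne_zero_iff_linearIndependent.2 (coordBasis he hy).linearIndependent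
    rwa [show (coordBasis he hy : Fin n → _) = coordVector e y from
      funext fun i => coordBasis_apply he hy i] at h
  have hGi : ContinuousOn (fun y => (Matrix.gram ℝ (coordVector e y))⁻¹) e.target := by
    simp_rw [Matrix.inv_def, Ring.inverse_eq_inv']
    exact (ContinuousOn.inv₀ (by fun_prop) hdet).smul (by fun_prop)
  have hF : ContinuousOn (fun y => (-1 : ℝ) ^ k *
      ((Matrix.gram ℝ (coordVector e y))⁻¹ *
        Matrix.gram ℝ (coordVector (transportChart f e) y)).charpoly.coeff (n - k)) e.target :=
    continuousOn_const.mul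
      ((continuous_coeff_charpoly (n - k)).comp_continuousOn (hGi.mul hH))
  have hcomp := (hF.comp e.continuousOn fun x hx => e.map_source hx).continuousAt
    (e.open_source.mem_nhds (mem_chart_source _ x₀))
  refine hcomp.congr ?_
  filter_upwards [e.open_source.mem_nhds (mem_chart_source _ x₀)] with x hx
  have hy : e x ∈ e.target := e.map_source hx
  have key : sqInvariant (mfderiv (𝓡 n) (𝓡 n) f (e.symm (e x))).toLinearMap k =
      (-1 : ℝ) ^ k * ((Matrix.gram ℝ (coordVector e (e x)))⁻¹ *
        Matrix.gram ℝ (coordVector (transportChart f e) (e x))).charpoly.coeff (n - k) := by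
    rw [sqInvariant_eq_coeff_charpoly _ (by rw [hfin]; exact hk), hfin,
      ← LinearMap.charpoly_toMatrix _ (coordBasis he hy), toMatrix_adjoint_comp_self,
      gram_transportChart f he hy, show (coordBasis he hy : Fin n → _) = coordVector e (e x) from
      funext fun i => coordBasis_apply he hy i]
  have hx' : sqInvariant (mfderiv (𝓡 n) (𝓡 n) f x).toLinearMap k =
      sqInvariant (mfderiv (𝓡 n) (𝓡 n) f (e.symm (e x))).toLinearMap k := by
    rw [e.left_inv hx]
  exact (hx'.trans key).symm

theorem continuous_jacobian_mfderiv (f : M ≃ₘ⟮𝓡 n, 𝓡 n⟯ N) :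
    Continuous fun x => jacobian (mfderiv (𝓡 n) (𝓡 n) f x).toLinearMap := by
  have h : (fun x => jacobian (mfderiv (𝓡 n) (𝓡 n) f x).toLinearMap) = fun x =>
      Real.sqrt (sqInvariant (mfderiv (𝓡 n) (𝓡 n) f x).toLinearMap n) := by
    funext x
    rw [← Real.sqrt_sq (jacobian_nonneg _), jacobian_sq_eq_sqInvariant]
    congr 2
    exact finrank_euclideanSpace_fin (𝕜 := ℝ) (n := n)
  rw [h]
  exact (continuous_sqInvariant_mfderiv f n).sqrt

end Transport

/-! ### Change of variables for the Riemannian volume -/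

section Volume

theorem withDensity_map {α β : Type*} [MeasurableSpace α] [MeasurableSpace β] {μ : Measure α}
    {g : α → β} (hg : AEMeasurable g μ) {h : β → ENNReal} (hh : Measurable h) :
    (μ.map g).withDensity h = (μ.withDensity (h ∘ g)).map g := by
  ext s hs
  have hg' : AEMeasurable g (μ.withDensity (h ∘ g)) :=
    hg.mono_ac (withDensity_absolutelyContinuous _ _)
  rw [withDensity_apply _ hs, Measure.restrict_map_of_aemeasurable hg hs,
    lintegral_map' hh.aemeasurable (hg.mono_measure Measure.restrict_le_self),
    Measure.map_apply_of_aemeasurable hg' hs, withDensity_apply₀]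
  · rfl
  · exact hg.nullMeasurableSet_preimage hs

theorem withDensity_mono_measure {α : Type*} [MeasurableSpace α] {μ ν : Measure α} (h : μ ≤ ν)
    (g : α → ENNReal) : μ.withDensity g ≤ ν.withDensity g := by
  refine Measure.le_iff.2 fun s hs => ?_
  rw [withDensity_apply _ hs, withDensity_apply _ hs]
  exact lintegral_mono' (Measure.restrict_mono le_rfl h) le_rfl

variable {n : ℕ}
  {M : Type*} [TopologicalSpace M] [ChartedSpace (EuclideanSpace ℝ (Fin n)) M]
  [RiemannianBundle (fun x : M => TangentSpace (𝓡 n) x)]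
  {N : Type*} [TopologicalSpace N] [ChartedSpace (EuclideanSpace ℝ (Fin n)) N]
  [RiemannianBundle (fun x : N => TangentSpace (𝓡 n) x)]

theorem lpNorm_eq_lintegral {k : ℕ} [MeasurableSpace M] {p : ℝ} (hp : 0 < p)
    (θ : DiffForm n M k) :
    lpNorm p θ =
      (∫⁻ x, ENNReal.ofReal (formNorm (θ x)) ^ p ∂(riemannianVolume n M)) ^ (1 / p) := by
  rw [lpNorm, eLpNorm_eq_lintegral_rpow_enorm_toReal (by simpa using hp) ENNReal.ofReal_ne_top,
    ENNReal.toReal_ofReal hp.le]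
  simp_rw [Real.enorm_of_nonneg (formNorm_nonneg _)]

/-- The Jacobian of a diffeomorphism as an extended nonnegative function. -/
def jacobianDensity (f : M ≃ₘ⟮𝓡 n, 𝓡 n⟯ N) (x : M) : ENNReal :=
  ENNReal.ofReal (jacobian (mfderiv (𝓡 n) (𝓡 n) f x).toLinearMap)

theorem jacobianDensity_ne_zero (f : M ≃ₘ⟮𝓡 n, 𝓡 n⟯ N) (x : M) : jacobianDensity f x ≠ 0 :=
  (ENNReal.ofReal_pos.2 (jacobian_pos (mfderiv_diffeomorph_injective f x))).ne'

theorem jacobianDensity_ne_top (f : M ≃ₘ⟮𝓡 n, 𝓡 n⟯ N) (x : M) : jacobianDensity f x ≠ ⊤ :=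
  ENNReal.ofReal_ne_top

variable [IsManifold (𝓡 n) ∞ M] [MeasurableSpace M] [BorelSpace M]
  [IsContMDiffRiemannianBundle (𝓡 n) ∞ (EuclideanSpace ℝ (Fin n))
    (fun x : M => TangentSpace (𝓡 n) x)]
  [IsManifold (𝓡 n) ∞ N]
  [IsContMDiffRiemannianBundle (𝓡 n) ∞ (EuclideanSpace ℝ (Fin n))
    (fun x : N => TangentSpace (𝓡 n) x)]

theorem measurable_jacobianDensity (f : M ≃ₘ⟮𝓡 n, 𝓡 n⟯ N) : Measurable (jacobianDensity f) :=
  (continuous_jacobian_mfderiv f).measurable.ennreal_ofReal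

variable [MeasurableSpace N] [BorelSpace N]

/-- Both chart measures come from densities on the same set `e.target`, and the ratio of these
densities is `J_f` by `sqrt_det_gram_map`. -/
theorem chartVolume_transportChart (f : M ≃ₘ⟮𝓡 n, 𝓡 n⟯ N)
    {e : OpenPartialHomeomorph M (EuclideanSpace ℝ (Fin n))}
    (he : e ∈ IsManifold.maximalAtlas (𝓡 n) ∞ M) :
    chartVolume (transportChart f e) =
      ((chartVolume e).withDensity (jacobianDensity f)).map f := by
  have hmeas : MeasurableSet e.target := e.open_target.measurableSet
  have hesymm : AEMeasurable e.symm (volume.restrict e.target) :=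
    e.continuousOn_symm.aemeasurable hmeas
  have hG : AEMeasurable (fun y => ENNReal.ofReal
      (Real.sqrt (Matrix.gram ℝ (coordVector e y)).det)) (volume.restrict e.target) := by
    refine AEMeasurable.ennreal_ofReal ?_
    have hc := continuousOn_gram_coordVector he
    exact (show ContinuousOn (fun y => Real.sqrt (Matrix.gram ℝ (coordVector e y)).det) e.target
      by fun_prop).aemeasurable hmeas
  have hf : Measurable f := f.continuous.measurable
  have hJ := measurable_jacobianDensity f
  have hdens : (volume.restrict e.target).withDensity (fun y => ENNReal.ofReal
      (Real.sqrt (Matrix.gram ℝ (coordVector (transportChart f e) y)).det)) =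
      ((volume.restrict e.target).withDensity (fun y => ENNReal.ofReal
        (Real.sqrt (Matrix.gram ℝ (coordVector e y)).det))).withDensity
          (jacobianDensity f ∘ e.symm) := by
    rw [← withDensity_mul₀ hG (hJ.comp_aemeasurable hesymm)]
    refine withDensity_congr_ae ?_
    filter_upwards [ae_restrict_mem hmeas] with y hy
    rw [gram_transportChart f he hy, sqrt_det_gram_map, Pi.mul_apply, Function.comp_apply,
      jacobianDensity, ENNReal.ofReal_mul (jacobian_nonneg _), mul_comm,
      show (coordBasis he hy : Fin n → _) = coordVector e y from
        funext fun i => coordBasis_apply he hy i]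
  have hesymm' : AEMeasurable e.symm ((volume.restrict e.target).withDensity (fun y =>
      ENNReal.ofReal (Real.sqrt (Matrix.gram ℝ (coordVector e y)).det))) :=
    hesymm.mono_ac (withDensity_absolutelyContinuous _ _)
  have hM : chartVolume e = ((volume.restrict e.target).withDensity (fun y => ENNReal.ofReal
      (Real.sqrt (Matrix.gram ℝ (coordVector e y)).det))).map e.symm := rfl
  have hN : chartVolume (transportChart f e) =
      ((volume.restrict e.target).withDensity (fun y => ENNReal.ofReal
        (Real.sqrt (Matrix.gram ℝ (coordVector (transportChart f e) y)).det))).map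
          (f ∘ e.symm) := rfl
  rw [hN, hdens, hM, withDensity_map hesymm' hJ,
    AEMeasurable.map_map_of_aemeasurable hf.aemeasurable
      (hesymm'.mono_ac (withDensity_absolutelyContinuous _ _))]

/-- Change of variables: `f_*(J_f dx) ≤ dy`. -/
theorem map_withDensity_jacobianDensity_le (f : M ≃ₘ⟮𝓡 n, 𝓡 n⟯ N) :
    ((riemannianVolume n M).withDensity (jacobianDensity f)).map f ≤ riemannianVolume n N := by
  have hf : Measurable f := f.continuous.measurable
  have hfs : Measurable f.symm := f.symm.continuous.measurable
  have hJ := measurable_jacobianDensity f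
  have hmap : ∀ μ : Measure M, (μ.map f).map f.symm = μ := by
    intro μ
    rw [Measure.map_map hfs hf, show f.symm ∘ f = id from funext f.symm_apply_apply,
      Measure.map_id]
  -- A supremum of measures can be bounded above chart by chart. The density is therefore moved to
  -- the other side as `J_f⁻¹`, leaving the volume of `M` alone on the left.
  have hle : riemannianVolume n M ≤
      ((riemannianVolume n N).map f.symm).withDensity (fun x => (jacobianDensity f x)⁻¹) := by
    refine iSup₂_le fun e he => ?_
    have h1 : chartVolume (transportChart f e) ≤ riemannianVolume n N :=
      le_iSup₂_of_le _ (transportChart_mem_maximalAtlas f he) le_rfl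
    rw [chartVolume_transportChart f he] at h1
    have h2 := Measure.map_mono h1 hfs
    rw [hmap] at h2
    have h3 := withDensity_mono_measure h2 (fun x => (jacobianDensity f x)⁻¹)
    rwa [withDensity_inv_same hJ (.of_forall (jacobianDensity_ne_zero f))
      (.of_forall (jacobianDensity_ne_top f))] at h3
  have h4 := withDensity_mono_measure hle (jacobianDensity f)
  have h5 : (((riemannianVolume n N).map f.symm).withDensity
      (fun x => (jacobianDensity f x)⁻¹)).withDensity (jacobianDensity f) =
        (riemannianVolume n N).map f.symm := by
    have h6 := withDensity_inv_same (μ := (riemannianVolume n N).map f.symm) hJ.inv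
      (.of_forall fun x => ENNReal.inv_ne_zero.2 (jacobianDensity_ne_top f x))
      (.of_forall fun x => ENNReal.inv_ne_top.2 (jacobianDensity_ne_zero f x))
    simpa only [Pi.inv_def, inv_inv] using h6
  rw [h5] at h4
  refine (Measure.map_mono h4 hf).trans_eq ?_
  rw [Measure.map_map hf hfs, show f ∘ f.symm = id from funext f.apply_symm_apply, Measure.map_id]

/-- As `J_f` vanishes nowhere, `dx` is absolutely continuous with respect to `J_f dx`, so the change
of variables controls null sets. -/
theorem ae_comp_of_ae (f : M ≃ₘ⟮𝓡 n, 𝓡 n⟯ N) {P : N → Prop}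
    (h : ∀ᵐ y ∂(riemannianVolume n N), P y) : ∀ᵐ x ∂(riemannianVolume n M), P (f x) := by
  have h1 := ae_mono (map_withDensity_jacobianDensity_le f) h
  have h2 : ∀ᵐ x ∂((riemannianVolume n M).withDensity (jacobianDensity f)), P (f x) :=
    ae_of_ae_map f.continuous.measurable.aemeasurable h1
  exact (withDensity_absolutelyContinuous' (measurable_jacobianDensity f).aemeasurable
    (.of_forall (jacobianDensity_ne_zero f))) h2

/-- Integrating a possibly non-measurable function over the image. -/
theorem lintegral_jacobianDensity_mul_comp_le (f : M ≃ₘ⟮𝓡 n, 𝓡 n⟯ N) (g : N → ENNReal) :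
    ∫⁻ x, jacobianDensity f x * g (f x) ∂(riemannianVolume n M) ≤
      ∫⁻ y, g y ∂(riemannianVolume n N) := by
  calc ∫⁻ x, jacobianDensity f x * g (f x) ∂(riemannianVolume n M)
      = ∫⁻ x, g (f x) ∂((riemannianVolume n M).withDensity (jacobianDensity f)) :=
        (lintegral_withDensity_eq_lintegral_mul_non_measurable _ (measurable_jacobianDensity f)
          (.of_forall fun x => (jacobianDensity_ne_top f x).lt_top) _).symm
    -- Since `f` is a measurable equivalence, this holds for arbitrary `g`.
    _ = ∫⁻ y, g y ∂(((riemannianVolume n M).withDensity (jacobianDensity f)).map f) :=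
        (lintegral_map_equiv g f.toHomeomorph.toMeasurableEquiv).symm
    _ ≤ ∫⁻ y, g y ∂(riemannianVolume n N) :=
        lintegral_mono' (map_withDensity_jacobianDensity_le f) le_rfl

end Volume

/-! ### Weighted Hölder inequality -/

section Holder

variable {X ε : Type*} [MeasurableSpace X] [ENorm ε] {μ : Measure X}

/-- The weighted Hölder inequality behind the distortion estimate, for measurable functions. -/
theorem lintegral_mul_rpow_le_of_measurable {p q : ℝ} (hp : 1 ≤ p) (hpq : p ≤ q) {t : ENNReal}
    (ht : t = ENNReal.ofReal p / ENNReal.ofReal (q - p)) {m J G : X → ENNReal} {D : X → ε}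
    (hm : Measurable m) (hJ : Measurable J) (hG : Measurable G) (hJ0 : ∀ x, J x ≠ 0)
    (hJtop : ∀ x, J x ≠ ⊤) (hD : ∀ x, m x ^ q ≤ ‖D x‖ₑ * J x) :
    (∫⁻ x, (m x * G x) ^ p ∂μ) ^ (1 / p) ≤
      eLpNorm D t μ ^ (1 / q) * (∫⁻ x, J x * G x ^ q ∂μ) ^ (1 / q) := by
  have hp0 : 0 < p := by linarith
  have hq0 : 0 < q := by linarith
  rcases hpq.eq_or_lt with rfl | hlt
  · have ht' : t = ⊤ := by
      rw [ht, sub_self, ENNReal.ofReal_zero, ENNReal.div_zero (by simpa using hp0)]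
    rw [ht', eLpNorm_exponent_top, ← ENNReal.mul_rpow_of_nonneg _ _ (by positivity)]
    refine ENNReal.rpow_le_rpow ?_ (by positivity)
    rw [← lintegral_const_mul _ (by fun_prop)]
    refine lintegral_mono_ae ?_
    filter_upwards [enorm_ae_le_eLpNormEssSup D μ] with x hx
    calc (m x * G x) ^ p = m x ^ p * G x ^ p := ENNReal.mul_rpow_of_nonneg _ _ hp0.le
      _ ≤ (‖D x‖ₑ * J x) * G x ^ p := by gcongr; exact hD x
      _ ≤ (eLpNormEssSup D μ * J x) * G x ^ p := by gcongr
      _ = eLpNormEssSup D μ * (J x * G x ^ p) := mul_assoc _ _ _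
  · have hqp : 0 < q - p := by linarith
    have htr : t = ENNReal.ofReal (p / (q - p)) := by rw [ht, ENNReal.ofReal_div_of_pos hqp]
    have hr0 : 0 < p / (q - p) := by positivity
    -- The reciprocals are `(q - p) / q` and `p / q`. The first exponent turns `m^p J^{-p/q}` into
    -- `(m^q / J)^t`, and the second turns `J^{p/q} G^p` into `J G^q`.
    have hconj : (q / (q - p)).HolderConjugate (q / p) := by
      rw [Real.holderConjugate_iff]
      refine ⟨by rw [lt_div_iff₀ hqp]; linarith, ?_⟩
      field_simp
      ring
    have hnorm : eLpNorm D t μ =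
        (∫⁻ x, ‖D x‖ₑ ^ (p / (q - p)) ∂μ) ^ (1 / (p / (q - p))) := by
      rw [htr, eLpNorm_eq_lintegral_rpow_enorm_toReal (by simpa using hr0)
        ENNReal.ofReal_ne_top, ENNReal.toReal_ofReal hr0.le]
    have hholder := ENNReal.lintegral_mul_le_Lp_mul_Lq μ hconj
      (f := fun x => m x ^ p * J x ^ (-(p / q))) (g := fun x => J x ^ (p / q) * G x ^ p)
      (by fun_prop) (by fun_prop)
    have hprod : ∀ x, (m x * G x) ^ p =
        ((fun x => m x ^ p * J x ^ (-(p / q))) * fun x => J x ^ (p / q) * G x ^ p) x := by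
      intro x
      rw [Pi.mul_apply, ENNReal.mul_rpow_of_nonneg _ _ hp0.le]
      calc m x ^ p * G x ^ p = m x ^ p * (J x ^ (-(p / q)) * J x ^ (p / q)) * G x ^ p := by
            rw [← ENNReal.rpow_add _ _ (hJ0 x) (hJtop x)]; simp
        _ = _ := by ring
    have hfirst : ∫⁻ x, (m x ^ p * J x ^ (-(p / q))) ^ (q / (q - p)) ∂μ ≤
        ∫⁻ x, ‖D x‖ₑ ^ (p / (q - p)) ∂μ := by
      refine lintegral_mono fun x => ?_
      have hdiv : m x ^ q * J x ^ (-1 : ℝ) ≤ ‖D x‖ₑ := by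
        rw [ENNReal.rpow_neg_one, ← div_eq_mul_inv]
        exact ENNReal.div_le_of_le_mul (hD x)
      calc (m x ^ p * J x ^ (-(p / q))) ^ (q / (q - p))
          = (m x ^ q * J x ^ (-1 : ℝ)) ^ (p / (q - p)) := by
            rw [ENNReal.mul_rpow_of_nonneg _ _ (by positivity),
              ENNReal.mul_rpow_of_nonneg _ _ hr0.le, ← ENNReal.rpow_mul, ← ENNReal.rpow_mul,
              ← ENNReal.rpow_mul, ← ENNReal.rpow_mul]
            congr 2 <;> field_simp
        _ ≤ ‖D x‖ₑ ^ (p / (q - p)) := ENNReal.rpow_le_rpow hdiv hr0.le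
    have hsecond : ∫⁻ x, (J x ^ (p / q) * G x ^ p) ^ (q / p) ∂μ = ∫⁻ x, J x * G x ^ q ∂μ := by
      refine lintegral_congr fun x => ?_
      rw [ENNReal.mul_rpow_of_nonneg _ _ (by positivity), ← ENNReal.rpow_mul, ← ENNReal.rpow_mul,
        show p / q * (q / p) = 1 by field_simp, show p * (q / p) = q by field_simp,
        ENNReal.rpow_one]
    simp_rw [hprod]
    calc _ ≤ ((∫⁻ x, ‖D x‖ₑ ^ (p / (q - p)) ∂μ) ^ (1 / (q / (q - p))) *
          (∫⁻ x, J x * G x ^ q ∂μ) ^ (1 / (q / p))) ^ (1 / p) := by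
          refine ENNReal.rpow_le_rpow (hholder.trans ?_) (by positivity)
          rw [hsecond]
          gcongr
      _ = _ := by
          rw [ENNReal.mul_rpow_of_nonneg _ _ (by positivity), hnorm, ← ENNReal.rpow_mul,
            ← ENNReal.rpow_mul, ← ENNReal.rpow_mul]
          congr 2 <;> field_simp

/-- The weighted Hölder inequality behind the distortion estimate. No measurability is needed of the
functions `h` and `G`. -/
theorem lintegral_rpow_le_of_le_mul {p q : ℝ} (hp : 1 ≤ p) (hpq : p ≤ q) {t : ENNReal}
    (ht : t = ENNReal.ofReal p / ENNReal.ofReal (q - p)) {m J G h : X → ENNReal} {D : X → ε}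
    (hm : Measurable m) (hJ : Measurable J) (hmtop : ∀ x, m x ≠ ⊤) (hJ0 : ∀ x, J x ≠ 0)
    (hJtop : ∀ x, J x ≠ ⊤) (hD : ∀ x, m x ^ q ≤ ‖D x‖ₑ * J x) (hh : ∀ x, h x ≤ m x * G x) :
    (∫⁻ x, h x ^ p ∂μ) ^ (1 / p) ≤
      eLpNorm D t μ ^ (1 / q) * (∫⁻ x, J x * G x ^ q ∂μ) ^ (1 / q) := by
  have hp0 : 0 < p := by linarith
  have hq0 : 0 < q := by linarith
  -- The lower integral of `h^p` is attained by a measurable minorant `u`. Dividing its `p`-th root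
  -- by `m` gives a measurable minorant of `G`, to which the measurable case applies.
  obtain ⟨u, hu, hule, hueq⟩ := exists_measurable_le_lintegral_eq μ fun x => h x ^ p
  set u' : X → ENNReal := fun x => u x ^ (1 / p) / m x with hu'
  have hroot : ∀ x, u x ^ (1 / p) ≤ h x := fun x => by
    rw [one_div, ENNReal.rpow_inv_le_iff hp0]
    exact hule x
  have hu'G : ∀ x, u' x ≤ G x := fun x =>
    ENNReal.div_le_of_le_mul (((hroot x).trans (hh x)).trans_eq (mul_comm _ _))
  have hmu' : ∀ x, m x * u' x = u x ^ (1 / p) := by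
    intro x
    -- Where `m` vanishes so does `h`, hence `u`, and dividing by zero loses nothing.
    by_cases hm0 : m x = 0
    · have : u x ^ (1 / p) ≤ 0 := by simpa [hm0] using (hroot x).trans (hh x)
      rw [hm0, zero_mul, le_antisymm this bot_le]
    · exact ENNReal.mul_div_cancel hm0 (hmtop x)
  have hu'meas : Measurable u' := by fun_prop
  calc (∫⁻ x, h x ^ p ∂μ) ^ (1 / p) = (∫⁻ x, (m x * u' x) ^ p ∂μ) ^ (1 / p) := by
        rw [hueq]
        congr 1
        refine lintegral_congr fun x => ?_
        rw [hmu', ← ENNReal.rpow_mul, one_div_mul_cancel hp0.ne', ENNReal.rpow_one]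
    _ ≤ eLpNorm D t μ ^ (1 / q) * (∫⁻ x, J x * u' x ^ q ∂μ) ^ (1 / q) :=
        lintegral_mul_rpow_le_of_measurable hp hpq ht hm hJ hu'meas hJ0 hJtop hD
    _ ≤ _ := by
        gcongr with x
        exact hu'G x

end Holder

/-! ### The norm estimate for the pullback and the bounded operator -/

section Pullback

variable {n k : ℕ}
  {M : Type*} [TopologicalSpace M] [ChartedSpace (EuclideanSpace ℝ (Fin n)) M]
  [IsManifold (𝓡 n) ∞ M] [MeasurableSpace M] [BorelSpace M]
  [RiemannianBundle (fun x : M => TangentSpace (𝓡 n) x)]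
  [IsContMDiffRiemannianBundle (𝓡 n) ∞ (EuclideanSpace ℝ (Fin n))
    (fun x : M => TangentSpace (𝓡 n) x)]
  {N : Type*} [TopologicalSpace N] [ChartedSpace (EuclideanSpace ℝ (Fin n)) N]
  [IsManifold (𝓡 n) ∞ N] [MeasurableSpace N] [BorelSpace N]
  [RiemannianBundle (fun x : N => TangentSpace (𝓡 n) x)]
  [IsContMDiffRiemannianBundle (𝓡 n) ∞ (EuclideanSpace ℝ (Fin n))
    (fun x : N => TangentSpace (𝓡 n) x)]

theorem lpNorm_pullback_le (f : M ≃ₘ⟮𝓡 n, 𝓡 n⟯ N) {p q : ℝ} (hp : 1 ≤ p) (hpq : p ≤ q)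
    {t : ENNReal} (ht : t = ENNReal.ofReal p / ENNReal.ofReal (q - p)) (θ : DiffForm n N k) :
    lpNorm p (pullback f k θ) ≤ distortionNorm f q t k ^ (1 / q) * lpNorm q θ := by
  have hp0 : 0 < p := by linarith
  have hq0 : 0 < q := by linarith
  -- Using this multiplier instead of `σ_k` itself provides measurability through continuity of
  -- `sqInvariant`; `σ_k` enters only in the pointwise bound by `D`.
  set m : M → ENNReal := fun x => ENNReal.ofReal
    (Real.sqrt (sqInvariant (mfderiv (𝓡 n) (𝓡 n) f x).toLinearMap k)) with hm_def
  have hm : Measurable m := (continuous_sqInvariant_mfderiv f k).sqrt.measurable.ennreal_ofReal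
  have hD : ∀ x, m x ^ q ≤ ‖distortion f q k x‖ₑ * jacobianDensity f x := by
    intro x
    have hJ := jacobian_pos (A := (mfderiv (𝓡 n) (𝓡 n) f x).toLinearMap)
      (mfderiv_diffeomorph_injective f x)
    have hσ := principalInvariant_nonneg (mfderiv (𝓡 n) (𝓡 n) f x).toLinearMap k
    rw [distortion, Real.enorm_of_nonneg (by positivity), jacobianDensity,
      ← ENNReal.ofReal_mul (by positivity), div_mul_cancel₀ _ hJ.ne', hm_def,
      ENNReal.ofReal_rpow_of_nonneg (Real.sqrt_nonneg _) hq0.le]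
    exact ENNReal.ofReal_le_ofReal (Real.rpow_le_rpow (Real.sqrt_nonneg _)
      (sqrt_sqInvariant_le_principalInvariant _ k) hq0.le)
  have hh : ∀ x, ENNReal.ofReal (formNorm (pullback f k θ x)) ≤
      m x * ENNReal.ofReal (formNorm (θ (f x))) := by
    intro x
    rw [hm_def, ← ENNReal.ofReal_mul (Real.sqrt_nonneg _)]
    exact ENNReal.ofReal_le_ofReal (formNorm_compContinuousLinearMap_le _
      (mfderiv_diffeomorph_injective f x) rfl _)
  rw [lpNorm_eq_lintegral hp0, lpNorm_eq_lintegral hq0]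
  refine (lintegral_rpow_le_of_le_mul hp hpq ht hm (measurable_jacobianDensity f)
    (fun x => ENNReal.ofReal_ne_top) (jacobianDensity_ne_zero f) (jacobianDensity_ne_top f)
    hD hh).trans ?_
  rw [distortionNorm]
  gcongr
  exact lintegral_jacobianDensity_mul_comp_le f fun y => ENNReal.ofReal (formNorm (θ y)) ^ q

theorem inducesBoundedOperator_pullback (f : M ≃ₘ⟮𝓡 n, 𝓡 n⟯ N) {p q : ℝ} (hp : 1 ≤ p)
    (hpq : p ≤ q) {t : ENNReal} (ht : t = ENNReal.ofReal p / ENNReal.ofReal (q - p))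
    (hf : BoundedDistortion f q t k) : InducesBoundedOperator q p (pullback f k) := by
  have hq0 : 0 < q := by linarith
  have hK : distortionNorm f q t k ^ (1 / q) ≠ ⊤ :=
    ENNReal.rpow_ne_top_of_nonneg (by positivity) hf.2.ne
  refine ⟨fun θ η _ _ h => ?_, fun θ hθ => ⟨hθ.1.pullback f, ?_⟩,
    ⟨(distortionNorm f q t k ^ (1 / q)).toNNReal, fun θ _ => ?_⟩⟩
  · filter_upwards [ae_comp_of_ae f h] with x hx
    change (θ (f x)).compContinuousLinearMap _ = (η (f x)).compContinuousLinearMap _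
    rw [hx]
  · exact (lpNorm_pullback_le f hp hpq ht θ).trans_lt (ENNReal.mul_lt_top hK.lt_top hθ.2)
  · rw [ENNReal.coe_toNNReal hK]
    exact lpNorm_pullback_le f hp hpq ht θ

end Pullback

end DistortedForms

end

theorem proposition4p2 (n k : ℕ)
    {M : Type*} [TopologicalSpace M] [T2Space M] [SecondCountableTopology M]
    [ChartedSpace (EuclideanSpace ℝ (Fin n)) M] [IsManifold (𝓡 n) ∞ M]
    [MeasurableSpace M] [BorelSpace M]
    [RiemannianBundle (fun x : M => TangentSpace (𝓡 n) x)]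
    [IsContMDiffRiemannianBundle (𝓡 n) ∞ (EuclideanSpace ℝ (Fin n))
      (fun x : M => TangentSpace (𝓡 n) x)]
    {N : Type*} [TopologicalSpace N] [T2Space N] [SecondCountableTopology N]
    [ChartedSpace (EuclideanSpace ℝ (Fin n)) N] [IsManifold (𝓡 n) ∞ N]
    [MeasurableSpace N] [BorelSpace N]
    [RiemannianBundle (fun x : N => TangentSpace (𝓡 n) x)]
    [IsContMDiffRiemannianBundle (𝓡 n) ∞ (EuclideanSpace ℝ (Fin n))
      (fun x : N => TangentSpace (𝓡 n) x)]
    (f : M ≃ₘ⟮𝓡 n, 𝓡 n⟯ N) (p q : ℝ) (hp : 1 ≤ p) (hpq : p ≤ q)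
    -- `t = p / (q - p) ∈ (0, ∞]`, which is `∞` when `q = p`
    (t : ENNReal) (ht : t = ENNReal.ofReal p / ENNReal.ofReal (q - p)) :
    (∀ θ : DistortedForms.DiffForm n N k, DistortedForms.MemLpForm q θ →
      DistortedForms.lpNorm p (DistortedForms.pullback f k θ) ≤
        DistortedForms.distortionNorm f q t k ^ (1 / q) * DistortedForms.lpNorm q θ) ∧
    (DistortedForms.BoundedDistortion f q t k →
      DistortedForms.InducesBoundedOperator q p (DistortedForms.pullback f k)) := by
  exact ⟨fun θ _ => DistortedForms.lpNorm_pullback_le f hp hpq ht θ,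
    DistortedForms.inducesBoundedOperator_pullback f hp hpq ht⟩
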